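/- Let $M$ be a smooth manifold of even dimension $n$, modelled on a real $n$-dimensional vector space $V$, and let $J(M)\to M$ be the bundle whose fibre at $x$ consists of all endomorphisms $j$ of $T_xM$ with $j^2=-1$, with projection $\pi$. A connection $\nabla$ in $TM$ defines an almost complex structure $J^\nabla$ on $J(M)$: with $\mathcal J$ the canonical section of $\operatorname{End}(\pi^*TM)$, $\mathcal J_j=j$, it is the unique field of endomorphisms of the tangent spaces of $J(M)$ such that, for every tangent vector $X$ of $J(M)$, $$d\pi(J^\nabla X)=\mathcal J\,d\pi(X),\qquad (\pi^*\nabla)_{J^\nabla X}\mathcal J=\mathcal J\,(\pi^*\nabla)_X\mathcal J .$$ Let $\nabla$ and $\nabla'=\nabla+A$ be two connections in $TM$, where $A$ is an $\operatorname{End}(TM)$-valued $1$-form, that is, a section of $T^*M\otimes T^*M\otimes TM$, and fix $j_0\in\operatorname{End}(V)$ with $j_0^2=-1$. The representation $V^*\otimes V^*\otimes V$ of $GL(V)$ is a finite direct sum of irreducible subrepresentations. For every such decomposition $V^*\otimes V^*\otimes V=\bigoplus_k W_k$, denote by $A_k$ the projection of $A$ to the subbundle of $T^*M\otimes T^*M\otimes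 TM$ associated to $W_k$ through the frame bundle of $M$ (the irreducible components of $A$). Then $J^\nabla=J^{\nabla'}$ on $J(M)$ if and only if there is no $k$ such that $A_k\neq 0$ and $3i$ is an eigenvalue of $j_0$, acting as an element of the Lie algebra $\mathfrak{gl}(V)$, on the complexification of $W_k$. -/

import Mathlib

open Bundle Filter
open scoped Manifold ContDiff Topology TensorProduct

noncomputable section

namespace Twistor

section Geometry

variable {E : Type*} [NormedAddCommGroup E] [NormedSpace ℝ E]
  {M : Type*} [TopologicalSpace M] [ChartedSpace E M] [IsManifold 𝓘(ℝ, E) ∞ M]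

variable (E M) in
/-- The total space of the smooth vector bundle `End TM`. -/
abbrev EndTotal : Type _ :=
  TotalSpace (E →L[ℝ] E)
    (fun x : M => TangentSpace 𝓘(ℝ, E) x →L[ℝ] TangentSpace 𝓘(ℝ, E) x)

variable (E) in
/-- The model with corners of the manifold `EndTotal E M`. -/
abbrev EndModel : ModelWithCorners ℝ (E × (E →L[ℝ] E)) (ModelProd E (E →L[ℝ] E)) :=
  𝓘(ℝ, E).prod 𝓘(ℝ, E →L[ℝ] E)

variable (E M) in
/-- The bundle `J(M)`, as a subset of `End TM`: all endomorphisms `j` of the tangent spaces of `M`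
with `j² = -1`. -/
def JBundle : Set (EndTotal E M) :=
  {p | ∀ u : TangentSpace 𝓘(ℝ, E) p.1, p.2 (p.2 u) = -u}

/-- The projection `π : End TM → M`; its restriction to `J(M)` is the bundle projection of
`J(M)`. -/
abbrev toBase : EndTotal E M → M := TotalSpace.proj

/-- The tangent space of `J(M)` at `p`: the space of velocities at `p` of the smooth curves in
`End TM` that stay in `J(M)`. For `p ∈ J(M)` these velocities already form a subspace, so that
taking the span adds nothing. -/
def JTangent (p : EndTotal E M) : Submodule ℝ (TangentSpace (EndModel E) p) :=
  Submodule.span ℝ {X | ∃ γ : ℝ → EndTotal E M, γ 0 = p ∧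
    ContMDiffAt 𝓘(ℝ, ℝ) (EndModel E) ∞ γ 0 ∧ (∀ᶠ t in 𝓝 (0 : ℝ), γ t ∈ JBundle E M) ∧
    (mfderiv 𝓘(ℝ, ℝ) (EndModel E) γ 0 (1 : ℝ) : E × (E →L[ℝ] E)) = X}

/-- The differential `dπ`. -/
def dProj (p : EndTotal E M) (X : TangentSpace (EndModel E) p) : TangentSpace 𝓘(ℝ, E) p.1 :=
  mfderiv (EndModel E) 𝓘(ℝ, E) (toBase : EndTotal E M → M) p X

/-- The pull-back connection `f^*∇` on the bundle `f^*TM`, for `f : N → M`. If `e_k` is the local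
frame of `TM` near `f q` given by a trivialization and `s = ∑ s_k (e_k ∘ f)`, then
`(f^*∇)_X s = ∑ (d s_k(X) e_k + s_k(q) ∇_{df(X)} e_k)`. The section `FiberBundle.extend E v` is the
one that is constant in the trivialization, with value `v` at the given point. -/
def pullbackConnection {E' : Type*} [NormedAddCommGroup E'] [NormedSpace ℝ E']
    {H' : Type*} [TopologicalSpace H'] {I' : ModelWithCorners ℝ E' H'}
    {N : Type*} [TopologicalSpace N] [ChartedSpace H' N]
    (cov : CovariantDerivative 𝓘(ℝ, E) E (TangentSpace 𝓘(ℝ, E) : M → Type _))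
    (f : N → M) (s : ∀ q : N, TangentSpace 𝓘(ℝ, E) (f q)) (q : N) (X : TangentSpace I' q) :
    TangentSpace 𝓘(ℝ, E) (f q) :=
  (trivializationAt E (TangentSpace 𝓘(ℝ, E)) (f q)).symm (f q)
      (mfderiv I' 𝓘(ℝ, E)
        (fun r : N => (trivializationAt E (TangentSpace 𝓘(ℝ, E)) (f q)
          (⟨f r, s r⟩ : TangentBundle 𝓘(ℝ, E) M)).2) q X)
    + cov (FiberBundle.extend E (s q)) (f q) (mfderiv I' 𝓘(ℝ, E) f q X)

/-- The covariant differential `π^*∇ 𝒥` of the canonical section `𝒥` of `End(π^*TM)`,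
`𝒥_j = j`, evaluated on a tangent vector `X` at `p` and on `u ∈ T_{π(p)}M`:
`((π^*∇)_X 𝒥) Y = (π^*∇)_X (𝒥 Y) - 𝒥 ((π^*∇)_X Y)` for a section `Y` of `π^*TM` through `u`. -/
def covDiffJ (cov : CovariantDerivative 𝓘(ℝ, E) E (TangentSpace 𝓘(ℝ, E) : M → Type _))
    (p : EndTotal E M) (X : TangentSpace (EndModel E) p) (u : TangentSpace 𝓘(ℝ, E) p.1) :
    TangentSpace 𝓘(ℝ, E) p.1 :=
  pullbackConnection (I' := EndModel E) cov toBase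
      (fun q : EndTotal E M => q.2 (FiberBundle.extend E u q.1)) p X
    - p.2 (pullbackConnection (I' := EndModel E) cov toBase
      (fun q : EndTotal E M => FiberBundle.extend E u q.1) p X)

/-- A field of endomorphisms of the tangent spaces of `J(M)` is the almost complex structure
defined by `∇` if `dπ (J X) = 𝒥 (dπ X)` and `π^*∇_{J X} 𝒥 = 𝒥 (π^*∇_X 𝒥)` for all `X`. -/
def IsTwistorStructure
    (cov : CovariantDerivative 𝓘(ℝ, E) E (TangentSpace 𝓘(ℝ, E) : M → Type _))
    (J : ∀ p : JBundle E M, JTangent p.1 →ₗ[ℝ] JTangent p.1) : Prop :=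
  ∀ (p : JBundle E M) (X : JTangent p.1),
    dProj p.1 (J p X) = p.1.2 (dProj p.1 X) ∧
    ∀ u, covDiffJ cov p.1 (J p X) u = p.1.2 (covDiffJ cov p.1 X u)


/-- The fibre coordinate of `End TM` in the trivialization at `x`. -/
def fibreCoord (x : M) (q : EndTotal E M) : E →L[ℝ] E :=
  (trivializationAt (E →L[ℝ] E)
    (fun x : M => TangentSpace 𝓘(ℝ, E) x →L[ℝ] TangentSpace 𝓘(ℝ, E) x) x q).2

lemma contMDiffAt_fibreCoord (p : EndTotal E M) :
    ContMDiffAt (EndModel E) 𝓘(ℝ, E →L[ℝ] E) ∞ (fibreCoord p.1) p := 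
  (contMDiffAt_totalSpace.1 (contMDiffAt_id (x := p))).2

lemma mfderiv_fibreCoord (p : EndTotal E M) :
    mfderiv (EndModel E) 𝓘(ℝ, E →L[ℝ] E) (fibreCoord p.1) p = ContinuousLinearMap.snd ℝ E (E →L[ℝ] E) := by
  have h := mfderiv_extChartAt_self (I := EndModel E) (x := p)
  have h2 : fibreCoord p.1 = (ContinuousLinearMap.snd ℝ E (E →L[ℝ] E)) ∘ extChartAt (EndModel E) p := by
    ext1 q
    simp [fibreCoord]
    rfl
  rw [h2, mfderiv_comp p (ContinuousLinearMap.snd ℝ E (E →L[ℝ] E)).mdifferentiableAt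
    (mdifferentiableAt_extChartAt (by simp)), h, ContinuousLinearMap.mfderiv_eq]
  rfl

lemma mfderiv_toBase (p : EndTotal E M) :
    mfderiv (EndModel E) 𝓘(ℝ, E) (toBase : EndTotal E M → M) p =
      ContinuousLinearMap.fst ℝ E (E →L[ℝ] E) := by
  have h := mfderiv_extChartAt_self (I := EndModel E) (x := p)
  have h' := mfderiv_extChartAt_self (I := 𝓘(ℝ, E)) (x := p.1)
  have h2 : extChartAt 𝓘(ℝ, E) p.1 ∘ toBase =ᶠ[𝓝 p] (ContinuousLinearMap.fst ℝ E (E →L[ℝ] E)) ∘ extChartAt (EndModel E) p := by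
    filter_upwards [] with q
    simp
    rfl
  have h3 := h2.mfderiv_eq (I := EndModel E) (I' := 𝓘(ℝ, E))
  rw [mfderiv_comp p (ContinuousLinearMap.fst ℝ E (E →L[ℝ] E)).mdifferentiableAt
    (mdifferentiableAt_extChartAt (by simp)), h, ContinuousLinearMap.mfderiv_eq,
    mfderiv_comp p (mdifferentiableAt_extChartAt (by simp)) (mdifferentiableAt_proj _), h'] at h3
  exact h3

lemma dProj_eq (p : EndTotal E M) (X : TangentSpace (EndModel E) p) :
    dProj p X = (show E × (E →L[ℝ] E) from X).1 := by
  rw [dProj, mfderiv_toBase]; rfl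

lemma trivializationAt_self_apply (x : M) (u : TangentSpace 𝓘(ℝ, E) x) :
    (trivializationAt E (TangentSpace 𝓘(ℝ, E)) x (⟨x, u⟩ : TangentBundle 𝓘(ℝ, E) M)).2 =
      (show E from u) := by
  have h := TangentBundle.continuousLinearMapAt_trivializationAt (I := 𝓘(ℝ, E)) (x₀ := x) (x := x)
    (by simp)
  rw [mfderiv_extChartAt_self] at h
  have h2 := congrArg (fun f : TangentSpace 𝓘(ℝ, E) x →L[ℝ] E => f u) h
  have h3 := mem_baseSet_trivializationAt E (TangentSpace 𝓘(ℝ, E)) x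
  simp only [Trivialization.continuousLinearMapAt_apply, Trivialization.linearMapAt_apply,
    if_pos h3] at h2
  exact h2

lemma trivializationAt_self_symm (x : M) (u : E) :
    (trivializationAt E (TangentSpace 𝓘(ℝ, E)) x).symm x u = (show TangentSpace 𝓘(ℝ, E) x from u) :=
  (congrArg ((trivializationAt E (TangentSpace 𝓘(ℝ, E)) x).symm x)
    (trivializationAt_self_apply x (show TangentSpace 𝓘(ℝ, E) x from u)).symm).trans
  ((trivializationAt E (TangentSpace 𝓘(ℝ, E)) x).symm_apply_apply_mk
    (mem_baseSet_trivializationAt E (TangentSpace 𝓘(ℝ, E)) x) u)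

lemma extend_eq (x y : M) (u : TangentSpace 𝓘(ℝ, E) x) :
    FiberBundle.extend E u y =
      (trivializationAt E (TangentSpace 𝓘(ℝ, E)) x).symm y (show E from u) :=
  congrArg ((trivializationAt E (TangentSpace 𝓘(ℝ, E)) x).symm y) (trivializationAt_self_apply x u)

lemma fibreCoord_apply (x : M) (q : EndTotal E M)
    (hq : q.1 ∈ (trivializationAt E (TangentSpace 𝓘(ℝ, E)) x).baseSet) (w : E) :
    fibreCoord x q w = (trivializationAt E (TangentSpace 𝓘(ℝ, E)) x ⟨q.1,
      (q.2 ((trivializationAt E (TangentSpace 𝓘(ℝ, E)) x).symm q.1 w))⟩).2 := by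
  have h1 : fibreCoord x q w =
      (trivializationAt E (TangentSpace 𝓘(ℝ, E)) x).continuousLinearMapAt ℝ q.1
      (q.2 ((trivializationAt E (TangentSpace 𝓘(ℝ, E)) x).symmL ℝ q.1 w)) := rfl
  rw [h1, Trivialization.continuousLinearMapAt_apply, Trivialization.linearMapAt_apply, if_pos hq,
    Trivialization.symmL_apply _ hq]

lemma fibreCoord_self (p : EndTotal E M) : fibreCoord p.1 p = (show E →L[ℝ] E from p.2) := by
  ext w
  rw [fibreCoord_apply _ _ (mem_baseSet_trivializationAt E (TangentSpace 𝓘(ℝ, E)) p.1),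
    trivializationAt_self_symm]
  exact trivializationAt_self_apply p.1 _

lemma eventually_mem_baseSet (p : EndTotal E M) :
    ∀ᶠ q in 𝓝 p, q.1 ∈ (trivializationAt E (TangentSpace 𝓘(ℝ, E)) p.1).baseSet :=
  (FiberBundle.continuous_proj (E →L[ℝ] E)
    (fun x : M => TangentSpace 𝓘(ℝ, E) x →L[ℝ] TangentSpace 𝓘(ℝ, E) x)).continuousAt.eventually
    ((trivializationAt E (TangentSpace 𝓘(ℝ, E)) p.1).open_baseSet.mem_nhds
      (mem_baseSet_trivializationAt E (TangentSpace 𝓘(ℝ, E)) p.1))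

lemma pullback_extend (cov : CovariantDerivative 𝓘(ℝ, E) E (TangentSpace 𝓘(ℝ, E) : M → Type _))
    (p : EndTotal E M) (X : TangentSpace (EndModel E) p) (u : TangentSpace 𝓘(ℝ, E) p.1) :
    pullbackConnection (I' := EndModel E) cov toBase
      (fun q : EndTotal E M => FiberBundle.extend E u q.1) p X =
    cov (FiberBundle.extend E u) p.1 (dProj p X) := by
  have h : (fun q : EndTotal E M => (trivializationAt E (TangentSpace 𝓘(ℝ, E)) p.1
          (⟨q.1, FiberBundle.extend E u q.1⟩ : TangentBundle 𝓘(ℝ, E) M)).2) =ᶠ[𝓝 p]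
        fun _ => (show E from u) := by
    filter_upwards [eventually_mem_baseSet p] with q hq
    rw [extend_eq, Trivialization.apply_mk_symm _ hq]
  have h1 : mfderiv (EndModel E) 𝓘(ℝ, E) (fun q : EndTotal E M =>
        (trivializationAt E (TangentSpace 𝓘(ℝ, E)) p.1
          (⟨q.1, FiberBundle.extend E u q.1⟩ : TangentBundle 𝓘(ℝ, E) M)).2) p X = (0 : E) := by
    rw [h.mfderiv_eq, mfderiv_const]; rfl
  have h2 := (congrArg ((trivializationAt E (TangentSpace 𝓘(ℝ, E)) p.1).symm p.1) h1).trans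
    (trivializationAt_self_symm p.1 0)
  have h3 : FiberBundle.extend E (FiberBundle.extend E u p.1) = FiberBundle.extend E u :=
    congrArg _ (FiberBundle.extend_apply_self E u)
  refine (congrArg₂ (· + ·) h2 (congrArg (fun s => cov s p.1 (dProj p X)) h3)).trans ?_
  exact zero_add _

lemma pullback_J_extend
    (cov : CovariantDerivative 𝓘(ℝ, E) E (TangentSpace 𝓘(ℝ, E) : M → Type _))
    (p : EndTotal E M) (X : TangentSpace (EndModel E) p) (u : TangentSpace 𝓘(ℝ, E) p.1) :
    pullbackConnection (I' := EndModel E) cov toBase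
      (fun q : EndTotal E M => q.2 (FiberBundle.extend E u q.1)) p X =
    (show TangentSpace 𝓘(ℝ, E) p.1 from (show E × (E →L[ℝ] E) from X).2 u) +
      cov (FiberBundle.extend E (p.2 u)) p.1 (dProj p X) := by
  have h : (fun q : EndTotal E M => (trivializationAt E (TangentSpace 𝓘(ℝ, E)) p.1
          (⟨q.1, q.2 (FiberBundle.extend E u q.1)⟩ : TangentBundle 𝓘(ℝ, E) M)).2) =ᶠ[𝓝 p]
        (ContinuousLinearMap.apply ℝ E (show E from u)) ∘ fibreCoord p.1 := by
    filter_upwards [eventually_mem_baseSet p] with q hq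
    rw [extend_eq, Function.comp, ContinuousLinearMap.apply_apply, fibreCoord_apply _ _ hq]
  have h1 : mfderiv (EndModel E) 𝓘(ℝ, E) (fun q : EndTotal E M =>
        (trivializationAt E (TangentSpace 𝓘(ℝ, E)) p.1
          (⟨q.1, q.2 (FiberBundle.extend E u q.1)⟩ : TangentBundle 𝓘(ℝ, E) M)).2) p X =
        (show E × (E →L[ℝ] E) from X).2 u := by
    rw [h.mfderiv_eq, mfderiv_comp p (ContinuousLinearMap.mdifferentiableAt _)
      ((contMDiffAt_fibreCoord p).mdifferentiableAt (by simp)), ContinuousLinearMap.mfderiv_eq,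
      mfderiv_fibreCoord]
    rfl
  have h2 := (congrArg ((trivializationAt E (TangentSpace 𝓘(ℝ, E)) p.1).symm p.1) h1).trans
    (trivializationAt_self_symm p.1 _)
  have h3 : FiberBundle.extend E (p.2 (FiberBundle.extend E u p.1)) =
      FiberBundle.extend E (p.2 u) :=
    congrArg (fun v => FiberBundle.extend E (p.2 v)) (FiberBundle.extend_apply_self E u)
  exact congrArg₂ (· + ·) h2 (congrArg (fun s => cov s p.1 (dProj p X)) h3)

lemma covDiffJ_eq (cov : CovariantDerivative 𝓘(ℝ, E) E (TangentSpace 𝓘(ℝ, E) : M → Type _))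
    (p : EndTotal E M) (X : TangentSpace (EndModel E) p) (u : TangentSpace 𝓘(ℝ, E) p.1) :
    covDiffJ cov p X u =
      (show TangentSpace 𝓘(ℝ, E) p.1 from (show E × (E →L[ℝ] E) from X).2 u)
      + cov (FiberBundle.extend E (p.2 u)) p.1 (dProj p X)
      - p.2 (cov (FiberBundle.extend E u) p.1 (dProj p X)) :=
  congrArg₂ (fun a b : TangentSpace 𝓘(ℝ, E) p.1 => a - p.2 b) (pullback_J_extend cov p X u)
    (pullback_extend cov p X u)

lemma eventually_extend_add (x : M) (u v : TangentSpace 𝓘(ℝ, E) x) :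
    ∀ᶠ y in 𝓝 x, FiberBundle.extend E (u + v) y =
      (FiberBundle.extend E u + FiberBundle.extend E v) y := by
  filter_upwards [(trivializationAt E (TangentSpace 𝓘(ℝ, E)) x).open_baseSet.mem_nhds
      (mem_baseSet_trivializationAt E (TangentSpace 𝓘(ℝ, E)) x)] with y hy
  rw [Pi.add_apply, extend_eq, extend_eq, extend_eq, ← Trivialization.symmL_apply (R := ℝ) _ hy,
    ← Trivialization.symmL_apply (R := ℝ) _ hy, ← Trivialization.symmL_apply (R := ℝ) _ hy]
  exact map_add ((trivializationAt E (TangentSpace 𝓘(ℝ, E)) x).symmL ℝ y) _ _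

lemma eventually_extend_smul (x : M) (c : ℝ) (u : TangentSpace 𝓘(ℝ, E) x) :
    ∀ᶠ y in 𝓝 x, FiberBundle.extend E (c • u) y = (c • FiberBundle.extend E u) y := by
  filter_upwards [(trivializationAt E (TangentSpace 𝓘(ℝ, E)) x).open_baseSet.mem_nhds
      (mem_baseSet_trivializationAt E (TangentSpace 𝓘(ℝ, E)) x)] with y hy
  rw [Pi.smul_apply, extend_eq, extend_eq, ← Trivialization.symmL_apply (R := ℝ) _ hy,
    ← Trivialization.symmL_apply (R := ℝ) _ hy]
  exact map_smul ((trivializationAt E (TangentSpace 𝓘(ℝ, E)) x).symmL ℝ y) _ _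

/-- The linear map `u ↦ ∇ (extend u)` at `x`, the connection form in the trivialization. -/
def connForm (cov : CovariantDerivative 𝓘(ℝ, E) E (TangentSpace 𝓘(ℝ, E) : M → Type _))
    (x : M) : E →ₗ[ℝ] E →L[ℝ] E where
  toFun u := cov (FiberBundle.extend E (show TangentSpace 𝓘(ℝ, E) x from u)) x
  map_add' u v := by
    have h := cov.isCovariantDerivativeOnUniv.congr_of_eventuallyEq
      (FiberBundle.mdifferentiableAt_extend ..)
      (mdifferentiableAt_add_section (FiberBundle.mdifferentiableAt_extend ..)
        (FiberBundle.mdifferentiableAt_extend ..))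
      univ_mem (eventually_extend_add x u v)
    exact h.trans (cov.isCovariantDerivativeOnUniv.add (FiberBundle.mdifferentiableAt_extend ..)
      (FiberBundle.mdifferentiableAt_extend ..))
  map_smul' c u := by
    have h := cov.isCovariantDerivativeOnUniv.congr_of_eventuallyEq
      (FiberBundle.mdifferentiableAt_extend ..)
      (mdifferentiableAt_const.smul_section (f := fun _ => c)
        (FiberBundle.mdifferentiableAt_extend ..))
      univ_mem (eventually_extend_smul x c u)
    exact h.trans (cov.isCovariantDerivativeOnUniv.smul_const c
      (FiberBundle.mdifferentiableAt_extend ..))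

lemma mem_JBundle_iff (x : M) (q : EndTotal E M)
    (hq : q.1 ∈ (trivializationAt E (TangentSpace 𝓘(ℝ, E)) x).baseSet) :
    q ∈ JBundle E M ↔ ∀ w, fibreCoord x q (fibreCoord x q w) = -w := by
  have key : ∀ w, (trivializationAt E (TangentSpace 𝓘(ℝ, E)) x).continuousLinearEquivAt ℝ q.1 hq
      (q.2 (((trivializationAt E (TangentSpace 𝓘(ℝ, E)) x).continuousLinearEquivAt ℝ q.1 hq).symm w))
      = fibreCoord x q w := fun w => (fibreCoord_apply x q hq w).symm
  set L := (trivializationAt E (TangentSpace 𝓘(ℝ, E)) x).continuousLinearEquivAt ℝ q.1 hq with hL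
  constructor
  · intro h w
    rw [← key (fibreCoord x q w), ← key w, L.symm_apply_apply, h, map_neg, L.apply_symm_apply]
  · intro h u
    have h1 := h (L u)
    rw [← key (fibreCoord x q _), ← key _, L.symm_apply_apply, L.symm_apply_apply] at h1
    exact L.injective (h1.trans (map_neg L u).symm)

/-- Velocities of curves in `J(M)` at `p` anticommute with `p.2` in the fibre direction. -/
lemma anticomm_of_mem (p : EndTotal E M) (X : TangentSpace (EndModel E) p) (hX : X ∈ JTangent p)
    (w : E) : (show E × (E →L[ℝ] E) from X).2 ((show E →L[ℝ] E from p.2) w)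
      + (show E →L[ℝ] E from p.2) ((show E × (E →L[ℝ] E) from X).2 w) = 0 := by
  induction hX using Submodule.span_induction with
  | mem X hX =>
    obtain ⟨γ, rfl, hγ, hJ, rfl⟩ := hX
    have hd := hγ.mdifferentiableAt (by simp)
    have hd2 := (contMDiffAt_fibreCoord (γ 0)).mdifferentiableAt (by simp)
    have h1 := hd2.hasMFDerivAt.comp (0 : ℝ) hd.hasMFDerivAt
    rw [mfderiv_fibreCoord] at h1
    have h1' : HasFDerivAt (fibreCoord (γ 0).1 ∘ γ) ((ContinuousLinearMap.snd ℝ E (E →L[ℝ] E)).comp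
        (show ℝ →L[ℝ] E × (E →L[ℝ] E) from mfderiv 𝓘(ℝ, ℝ) (EndModel E) γ 0)) 0 := h1.hasFDerivAt
    have h2 := h1'.hasDerivAt
    have h3 := h2.clm_comp h2
    have h4 : (fun t => ((fibreCoord (γ 0).1 ∘ γ) t).comp ((fibreCoord (γ 0).1 ∘ γ) t)) =ᶠ[𝓝 0]
        fun _ => -ContinuousLinearMap.id ℝ E := by
      filter_upwards [hJ, hγ.continuousAt.eventually (eventually_mem_baseSet (γ 0))] with t ht ht2
      ext w
      exact (mem_JBundle_iff _ _ ht2).1 ht w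
    have h5 := h3.unique ((hasDerivAt_const (0 : ℝ) (-ContinuousLinearMap.id ℝ E)).congr_of_eventuallyEq h4)
    have h6 := congrArg (fun f : E →L[ℝ] E => f w) h5
    simp only [Function.comp, fibreCoord_self] at h6
    exact h6
  | zero => exact (zero_add _).trans (map_zero (show E →L[ℝ] E from p.2))
  | add X Y _ _ hX hY =>
    have := congrArg₂ (· + ·) hX hY
    simp only [add_zero] at this
    rw [← this]
    refine (congrArg₂ (· + ·) rfl (map_add (show E →L[ℝ] E from p.2) _ _)).trans ?_
    exact add_add_add_comm _ _ _ _
  | smul c X _ hX =>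
    have := congrArg (c • ·) hX
    simp only [smul_zero, smul_add] at this
    rw [← this]
    exact congrArg₂ (· + ·) rfl (map_smul (show E →L[ℝ] E from p.2) c _)

variable [FiniteDimensional ℝ E]

lemma mem_JTangent_of_anticomm (p : EndTotal E M) (hp : p ∈ JBundle E M)
    (v : E) (W : E →L[ℝ] E)
    (hW : ∀ w, W ((show E →L[ℝ] E from p.2) w) + (show E →L[ℝ] E from p.2) (W w) = 0) :
    (show TangentSpace (EndModel E) p from (v, W)) ∈ JTangent p := by
  have : CompleteSpace E := FiniteDimensional.complete ℝ E
  let _ : NormedAlgebra ℚ (E →L[ℝ] E) := NormedAlgebra.restrictScalars ℚ ℝ _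
  obtain ⟨j, hj⟩ : ∃ j : E →L[ℝ] E, j = p.2 := ⟨_, rfl⟩
  have hjj : j * j = -1 := by ext w; rw [hj]; exact hp w
  have hWj : W * j + j * W = 0 := by ext w; rw [hj]; exact hW w
  set B : E →L[ℝ] E := -((1 / 2 : ℝ) • (W * j)) with hB
  have hBj : B * j - j * B = W := by
    have h1 : j * W = -(W * j) := eq_neg_of_add_eq_zero_right hWj
    have h2 : W * j * j = -W := by rw [mul_assoc, hjj, mul_neg, mul_one]
    have h3 : j * (W * j) = W := by rw [← mul_assoc, h1, neg_mul, h2, neg_neg]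
    rw [hB, neg_mul, mul_neg, smul_mul_assoc, mul_smul_comm, h2, h3]
    module
  -- the curve `t ↦ exp (t B) j exp (-t B)`
  set c : ℝ → E →L[ℝ] E := fun t => NormedSpace.exp (t • B) * j * NormedSpace.exp (t • (-B)) with hc
  have hexp : ∀ t : ℝ, NormedSpace.exp (t • (-B)) * NormedSpace.exp (t • B) = 1 := by
    intro t
    rw [← NormedSpace.exp_add_of_commute]
    · simp
    · exact ((Commute.refl B).neg_left.smul_left t).smul_right t
  have hcc : ∀ t, c t * c t = -1 := by
    intro t
    have h1 := hexp t
    have h2 : NormedSpace.exp (t • B) * NormedSpace.exp (t • (-B)) = 1 := by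
      have := hexp (-t)
      simpa using this
    calc c t * c t = NormedSpace.exp (t • B) * j * (NormedSpace.exp (t • (-B)) *
          NormedSpace.exp (t • B)) * j * NormedSpace.exp (t • (-B)) := by
          simp only [hc, mul_assoc]
      _ = NormedSpace.exp (t • B) * (j * j) * NormedSpace.exp (t • (-B)) := by
          rw [h1, mul_one, mul_assoc _ j j]
      _ = -1 := by rw [hjj, mul_neg, mul_one, neg_mul, h2]
  have hc0 : c 0 = j := by simp [hc]
  have hcd : HasDerivAt c W 0 := by
    have h1 := hasDerivAt_exp_smul_const (𝕂 := ℝ) B (0 : ℝ)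
    have h2 := hasDerivAt_exp_smul_const (𝕂 := ℝ) (-B) (0 : ℝ)
    have h3 := (h1.mul_const j).mul h2
    simp only [zero_smul, NormedSpace.exp_zero, one_mul, mul_one] at h3
    rw [mul_neg, ← sub_eq_add_neg, hBj] at h3
    exact h3
  have hcs : ContDiff ℝ ∞ c := by
    have h1 : ∀ B : E →L[ℝ] E, ContDiff ℝ ∞ fun t : ℝ => NormedSpace.exp (t • B) := by
      intro B
      have h2 : ContDiff ℝ ∞ (NormedSpace.exp : (E →L[ℝ] E) → (E →L[ℝ] E)) :=
        contDiff_iff_contDiffAt.2 fun x => (NormedSpace.exp_analytic (𝕂 := ℝ) x).contDiffAt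
      exact h2.comp (contDiff_id.smul contDiff_const)
    exact ((h1 B).mul contDiff_const).mul (h1 (-B))
  set δ : ℝ → E × (E →L[ℝ] E) := fun t => (extChartAt 𝓘(ℝ, E) p.1 p.1 + t • v, c t) with hδ
  have hδs : ContDiff ℝ ∞ δ := by
    exact (contDiff_const.add (contDiff_id.smul contDiff_const)).prodMk hcs
  have hδ0 : δ 0 = extChartAt (EndModel E) p p := by
    refine Prod.ext ?_ ?_
    · simp only [hδ, zero_smul, add_zero]
      simp
      rfl
    · simp only [hδ, hc0, hj, ← fibreCoord_self]
      simp
      rfl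
  have hδd : HasDerivAt δ (v, W) 0 := by
    refine HasDerivAt.prodMk ?_ hcd
    simpa using ((hasDerivAt_id (0 : ℝ)).smul_const v).const_add (extChartAt 𝓘(ℝ, E) p.1 p.1)
  have htgt : ∀ᶠ t in 𝓝 (0 : ℝ), δ t ∈ (extChartAt (EndModel E) p).target := by
    apply hδs.continuous.continuousAt.eventually
    rw [hδ0]
    exact extChartAt_target_mem_nhds p
  set γ : ℝ → EndTotal E M := fun t => (extChartAt (EndModel E) p).symm (δ t) with hγ
  have hγ0 : γ 0 = p := by
    simp only [hγ, hδ0]; exact extChartAt_to_inv p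
  have hγs : ContMDiffAt 𝓘(ℝ, ℝ) (EndModel E) ∞ γ 0 := by
    have h1 := (contMDiffOn_extChartAt_symm (I := EndModel E) (n := ∞) p).contMDiffAt
      (extChartAt_target_mem_nhds p)
    rw [← hδ0] at h1
    exact h1.comp (0 : ℝ) hδs.contMDiff.contMDiffAt
  have hext : ∀ᶠ t in 𝓝 (0 : ℝ), extChartAt (EndModel E) p (γ t) = δ t := by
    filter_upwards [htgt] with t ht
    exact (extChartAt (EndModel E) p).right_inv ht
  have hsnd : ∀ q, fibreCoord p.1 q = (extChartAt (EndModel E) p q).2 := by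
    intro q
    simp [fibreCoord]
    rfl
  refine Submodule.subset_span ⟨γ, hγ0, hγs, ?_, ?_⟩
  · have h0 := eventually_mem_baseSet p
    rw [← hγ0] at h0
    filter_upwards [hext, hγs.continuousAt.eventually h0] with t h1 h2
    rw [hγ0] at h2
    rw [mem_JBundle_iff _ _ h2, hsnd, h1]
    intro w
    exact congrArg (fun f : E →L[ℝ] E => f w) (hcc t)
  · have h1 : mfderiv 𝓘(ℝ, ℝ) 𝓘(ℝ, E × (E →L[ℝ] E)) (extChartAt (EndModel E) p ∘ γ) 0 =
        mfderiv 𝓘(ℝ, ℝ) 𝓘(ℝ, E × (E →L[ℝ] E)) δ 0 := Filter.EventuallyEq.mfderiv_eq hext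
    have h2 : MDifferentiableAt (EndModel E) 𝓘(ℝ, E × (E →L[ℝ] E)) (extChartAt (EndModel E) p)
        (γ 0) := by
      rw [hγ0]; exact mdifferentiableAt_extChartAt (by simp)
    have h3 : (show E × (E →L[ℝ] E) →L[ℝ] E × (E →L[ℝ] E) from
        mfderiv (EndModel E) 𝓘(ℝ, E × (E →L[ℝ] E)) (extChartAt (EndModel E) p) (γ 0)) =
        ContinuousLinearMap.id ℝ _ := by
      rw [hγ0]; exact mfderiv_extChartAt_self
    rw [mfderiv_comp (0 : ℝ) h2 (hγs.mdifferentiableAt (by simp)), mfderiv_eq_fderiv,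
      hδd.hasFDerivAt.fderiv] at h1
    have h4 := congrArg (fun f : ℝ →L[ℝ] E × (E →L[ℝ] E) => f 1) h1
    have h5 := congrArg (fun f : E × (E →L[ℝ] E) →L[ℝ] E × (E →L[ℝ] E) =>
      f (mfderiv 𝓘(ℝ, ℝ) (EndModel E) γ 0 (1 : ℝ))) h3
    refine (h5.symm.trans h4).trans ?_
    exact one_smul ℝ ((v, W) : E × (E →L[ℝ] E))

/-- `connForm` with its arguments exchanged: `v ↦ (u ↦ ∇_v (extend u))`. -/
def connForm' (cov : CovariantDerivative 𝓘(ℝ, E) E (TangentSpace 𝓘(ℝ, E) : M → Type _))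
    (x : M) : E →ₗ[ℝ] E →L[ℝ] E :=
  LinearMap.toContinuousLinearMap.toLinearMap ∘ₗ
    (ContinuousLinearMap.coeLM ℝ ∘ₗ connForm cov x).flip

/-- An auxiliary formula for the almost complex structure in the coordinates at `p`. -/
def auxJ (cov : CovariantDerivative 𝓘(ℝ, E) E (TangentSpace 𝓘(ℝ, E) : M → Type _))
    (x : M) (j : E →L[ℝ] E) : E × (E →L[ℝ] E) →ₗ[ℝ] E × (E →L[ℝ] E) where
  toFun X := (j X.1, j * (X.2 + (connForm' cov x X.1 * j - j * connForm' cov x X.1)) -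
    (connForm' cov x (j X.1) * j - j * connForm' cov x (j X.1)))
  map_add' X Y := by
    refine Prod.ext ?_ ?_
    · simp
    · simp only [Prod.fst_add, Prod.snd_add, map_add]
      noncomm_ring
  map_smul' c X := by
    refine Prod.ext ?_ ?_
    · simp
    · simp only [Prod.smul_fst, Prod.smul_snd, map_smul, RingHom.id_apply, smul_mul_assoc,
        mul_smul_comm, smul_sub, smul_add, mul_add, mul_sub]

lemma auxJ_spec (cov : CovariantDerivative 𝓘(ℝ, E) E (TangentSpace 𝓘(ℝ, E) : M → Type _))
    (x : M) (j : E →L[ℝ] E) (X : E × (E →L[ℝ] E)) :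
    (auxJ cov x j X).2 + (connForm' cov x (auxJ cov x j X).1 * j
      - j * connForm' cov x (auxJ cov x j X).1) =
    j * (X.2 + (connForm' cov x X.1 * j - j * connForm' cov x X.1)) := sub_add_cancel _ _

lemma covDiffJ_eq' (cov : CovariantDerivative 𝓘(ℝ, E) E (TangentSpace 𝓘(ℝ, E) : M → Type _))
    (p : EndTotal E M) (j : E →L[ℝ] E) (hj : j = p.2) (X : E × (E →L[ℝ] E)) (u : E) :
    covDiffJ cov p X u =
      (X.2 + (connForm' cov p.1 X.1 * j - j * connForm' cov p.1 X.1)) u := by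
  subst hj
  refine (covDiffJ_eq cov p X u).trans ?_
  have h : dProj p X = X.1 := dProj_eq p X
  refine Eq.trans ?_ (add_sub_assoc (X.2 u) (connForm' cov p.1 X.1 ((show E →L[ℝ] E from p.2) u))
    ((show E →L[ℝ] E from p.2) (connForm' cov p.1 X.1 u)))
  exact congrArg (fun v : TangentSpace 𝓘(ℝ, E) p.1 =>
    (show TangentSpace 𝓘(ℝ, E) p.1 from X.2 u) + cov (FiberBundle.extend E (p.2 u)) p.1 v
      - p.2 (cov (FiberBundle.extend E u) p.1 v)) h

lemma tangent_ext (cov : CovariantDerivative 𝓘(ℝ, E) E (TangentSpace 𝓘(ℝ, E) : M → Type _))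
    (p : EndTotal E M) (X Y : TangentSpace (EndModel E) p) (h1 : dProj p X = dProj p Y)
    (h2 : ∀ u, covDiffJ cov p X u = covDiffJ cov p Y u) : X = Y := by
  rw [dProj_eq, dProj_eq] at h1
  have h1' : (show E × (E →L[ℝ] E) from X).1 = (show E × (E →L[ℝ] E) from Y).1 := h1
  refine Prod.ext h1' ?_
  ext u
  have h3 := h2 u
  erw [covDiffJ_eq' cov p _ rfl X u, covDiffJ_eq' cov p _ rfl Y u] at h3
  rw [h1'] at h3
  exact add_right_cancel h3

/-- There is a unique almost complex structure defined by `∇`. -/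
theorem existsUnique_isTwistorStructure
    (cov : CovariantDerivative 𝓘(ℝ, E) E (TangentSpace 𝓘(ℝ, E) : M → Type _)) :
    ∃! J : ∀ p : JBundle E M, JTangent p.1 →ₗ[ℝ] JTangent p.1, IsTwistorStructure cov J := by
  have hmem : ∀ (p : JBundle E M) (X : E × (E →L[ℝ] E)), X ∈ JTangent p.1 →
      auxJ cov p.1.1 p.1.2 X ∈ JTangent p.1 := by
    intro p X hX
    refine mem_JTangent_of_anticomm p.1 p.2 _ _ fun w => ?_
    obtain ⟨j, hj⟩ : ∃ j : E →L[ℝ] E, j = p.1.2 := ⟨_, rfl⟩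
    have hjj : j * j = -1 := by ext w; rw [hj]; exact p.2 w
    have hX' : X.2 * j + j * X.2 = 0 := by
      ext w; rw [hj]; exact anticomm_of_mem p.1 X hX w
    have key : ∀ G G' : E →L[ℝ] E,
        (j * (X.2 + (G * j - j * G)) - (G' * j - j * G')) * j +
          j * (j * (X.2 + (G * j - j * G)) - (G' * j - j * G')) = 0 := by
      intro G G'
      have e1 : (j * (X.2 + (G * j - j * G)) - (G' * j - j * G')) * j +
          j * (j * (X.2 + (G * j - j * G)) - (G' * j - j * G')) =
          j * (X.2 * j + j * X.2) + j * G * (j * j) - (j * j) * G * j + (j * j) * G * j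
            - j * (j * j) * G - G' * (j * j) + (j * j) * G' := by
        noncomm_ring
      rw [e1, hX', hjj]
      noncomm_ring
    have := congrArg (fun f : E →L[ℝ] E => f w)
      (key (connForm' cov p.1.1 X.1) (connForm' cov p.1.1 (j X.1)))
    rw [hj] at this
    exact this
  refine ⟨fun p => (auxJ cov p.1.1 p.1.2).restrict (hmem p), ?_, ?_⟩
  · intro p X
    constructor
    · rw [dProj_eq, dProj_eq]; rfl
    · intro u
      obtain ⟨j, hj⟩ : ∃ j : E →L[ℝ] E, j = p.1.2 := ⟨_, rfl⟩
      refine (covDiffJ_eq' cov p.1 j hj _ u).trans ?_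
      refine Eq.trans ?_ (congrArg p.1.2 (covDiffJ_eq' cov p.1 j hj X.1 u).symm)
      subst hj
      exact congrArg (fun f : E →L[ℝ] E => f u) (auxJ_spec cov p.1.1 p.1.2 X.1)
  · intro J hJ
    funext p
    ext1 X
    apply Subtype.ext
    obtain ⟨j, hj⟩ : ∃ j : E →L[ℝ] E, j = p.1.2 := ⟨_, rfl⟩
    refine tangent_ext cov p.1 _ _ ?_ ?_
    · rw [(hJ p X).1, dProj_eq, dProj_eq]; rfl
    · intro u
      rw [(hJ p X).2 u]
      refine Eq.trans (congrArg p.1.2 (covDiffJ_eq' cov p.1 j hj X.1 u))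
        (Eq.trans ?_ (covDiffJ_eq' cov p.1 j hj _ u).symm)
      subst hj
      exact (congrArg (fun f : E →L[ℝ] E => f u) (auxJ_spec cov p.1.1 p.1.2 X.1)).symm

/-- The almost complex structure `J^∇` on `J(M)` defined by the connection `∇`. -/
def twistorStructure
    (cov : CovariantDerivative 𝓘(ℝ, E) E (TangentSpace 𝓘(ℝ, E) : M → Type _)) :
    ∀ p : JBundle E M, JTangent p.1 →ₗ[ℝ] JTangent p.1 :=
  (existsUnique_isTwistorStructure cov).choose

theorem isTwistorStructure_twistorStructure
    (cov : CovariantDerivative 𝓘(ℝ, E) E (TangentSpace 𝓘(ℝ, E) : M → Type _)) :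
    IsTwistorStructure cov (twistorStructure cov) :=
  (existsUnique_isTwistorStructure cov).choose_spec.1

theorem twistorStructure_sq
    (cov : CovariantDerivative 𝓘(ℝ, E) E (TangentSpace 𝓘(ℝ, E) : M → Type _))
    (p : JBundle E M) (X : JTangent p.1) :
    twistorStructure cov p (twistorStructure cov p X) = -X := by
  have h := isTwistorStructure_twistorStructure cov p
  apply Subtype.ext
  refine tangent_ext cov p.1 _ _ ?_ ?_
  · rw [(h _).1, (h _).1, p.2, dProj, dProj]
    exact (map_neg (mfderiv (EndModel E) 𝓘(ℝ, E) (toBase : EndTotal E M → M) p.1) X.1).symm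
  · intro u
    rw [(h _).2, (h _).2, p.2]
    obtain ⟨j, hj⟩ : ∃ j : E →L[ℝ] E, j = p.1.2 := ⟨_, rfl⟩
    refine (congrArg Neg.neg (covDiffJ_eq' cov p.1 j hj X.1 u)).trans
      (Eq.trans ?_ (covDiffJ_eq' cov p.1 j hj (-X.1 : E × (E →L[ℝ] E)) u).symm)
    obtain ⟨Y, hY⟩ : ∃ Y : E × (E →L[ℝ] E), Y = X.1 := ⟨_, rfl⟩
    rw [← hY]
    have key : -(Y.2 + (connForm' cov p.1.1 Y.1 * j - j * connForm' cov p.1.1 Y.1)) =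
        (-Y).2 + (connForm' cov p.1.1 (-Y).1 * j - j * connForm' cov p.1.1 (-Y).1) := by
      simp only [Prod.fst_neg, Prod.snd_neg, map_neg]
      noncomm_ring
    exact congrArg (fun f : E →L[ℝ] E => f u) key

end Geometry

section Representation

variable (V : Type*) [AddCommGroup V] [Module ℝ V]

/-- The space `V* ⊗ V* ⊗ V` for a finite-dimensional `V`, as the space of bilinear maps
`V × V → V`. -/
abbrev Tensors : Type _ := V →ₗ[ℝ] V →ₗ[ℝ] V

/-- The standard representation of `GL(V)` on `V`. -/
def stdRep : Representation ℝ (LinearMap.GeneralLinearGroup ℝ V) V :=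
  Units.coeHom (Module.End ℝ V)

/-- The representation of `GL(V)` on `V* ⊗ V* ⊗ V`. -/
def tensorRep : Representation ℝ (LinearMap.GeneralLinearGroup ℝ V) (Tensors V) :=
  (stdRep V).linHom ((stdRep V).linHom (stdRep V))

variable {V}

lemma tensorRep_apply (g : LinearMap.GeneralLinearGroup ℝ V) (T : Tensors V) (u v : V) :
    tensorRep V g T u v = g.val (T (g⁻¹.val u) (g⁻¹.val v)) := rfl

/-- The action of `j ∈ gl(V)` on `V* ⊗ V* ⊗ V`, by derivations. -/
def glAction (j : V →ₗ[ℝ] V) : Module.End ℝ (Tensors V) where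
  toFun T := T.compr₂ j - T.comp j - T.compl₂ j
  map_add' S T := by
    ext u v
    simp only [LinearMap.sub_apply, LinearMap.add_apply, LinearMap.compr₂_apply,
      LinearMap.comp_apply, LinearMap.compl₂_apply, map_add]
    abel
  map_smul' c T := by
    ext u v
    simp only [LinearMap.sub_apply, LinearMap.smul_apply, LinearMap.compr₂_apply,
      LinearMap.comp_apply, LinearMap.compl₂_apply, map_smul, smul_sub, RingHom.id_apply]

lemma glAction_apply (j : V →ₗ[ℝ] V) (T : Tensors V) (u v : V) :
    glAction j T u v = j (T u v) - T (j u) v - T u (j v) := rfl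

/-- The action of `j` on (the complexification of) the subspace `S` has the eigenvalue `3i`. -/
def HasThreeIEigenvalue (j : V →ₗ[ℝ] V) (S : Submodule ℝ (Tensors V)) : Prop :=
  ∃ w ∈ S.baseChange ℂ,
    Module.End.HasEigenvector ((glAction j).baseChange ℂ) (3 * Complex.I) w

variable (V) in
/-- A decomposition of `V* ⊗ V* ⊗ V` as a direct sum of `k` irreducible subrepresentations
of `GL(V)`. -/
structure IrreducibleDecomposition (k : ℕ) where
  /-- The summands. -/
  summand : Fin k → Subrepresentation (tensorRep V)
  irreducible : ∀ i,
    Representation.IsIrreducible (k := ℝ) (V := (summand i).toSubmodule) (summand i).toRepresentation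
  isInternal : DirectSum.IsInternal fun i => (summand i).toSubmodule

/-- The projection of `V* ⊗ V* ⊗ V` to the `i`-th summand. -/
def IrreducibleDecomposition.proj {k : ℕ} (D : IrreducibleDecomposition V k) (i : Fin k) :
    Tensors V →ₗ[ℝ] (D.summand i).toSubmodule :=
  DirectSum.component ℝ (Fin k) (fun i => (D.summand i).toSubmodule) i ∘ₗ
    (LinearEquiv.ofBijective
      (DirectSum.coeLinearMap fun i => (D.summand i).toSubmodule) D.isInternal).symm.toLinearMap

end Representation

section Components

variable {E : Type*} [NormedAddCommGroup E] [NormedSpace ℝ E]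
  {M : Type*} [TopologicalSpace M] [ChartedSpace E M]

/-- An element of `T_x^*M ⊗ T_x^*M ⊗ T_xM`, expressed in a frame `b : V ≃ T_xM`. -/
def inFrame {x : M} (b : E ≃ₗ[ℝ] TangentSpace 𝓘(ℝ, E) x)
    (T : TangentSpace 𝓘(ℝ, E) x →L[ℝ] TangentSpace 𝓘(ℝ, E) x →L[ℝ] TangentSpace 𝓘(ℝ, E) x) :
    Tensors E :=
  LinearMap.mk₂ ℝ (fun u v => b.symm (T (b u) (b v)))
    (by intros; simp) (by intros; simp) (by intros; simp) (by intros; simp)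

/-- The `i`-th irreducible component of a section `A` of `T^*M ⊗ T^*M ⊗ TM`, as a section of the
bundle associated to the `i`-th summand, that is, as a function on the frame bundle with values in
that summand. -/
def irreducibleComponent {k : ℕ} (D : IrreducibleDecomposition E k) (i : Fin k)
    (A : ∀ x : M, TangentSpace 𝓘(ℝ, E) x →L[ℝ] TangentSpace 𝓘(ℝ, E) x →L[ℝ]
      TangentSpace 𝓘(ℝ, E) x)
    (x : M) (b : E ≃ₗ[ℝ] TangentSpace 𝓘(ℝ, E) x) : (D.summand i).toSubmodule :=
  D.proj i (inFrame b (A x))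

end Components

end Twistor

end

/-! Passing from `∇` to `∇ + A` changes the covariant differential of `𝒥` at `j` in the direction
`X` by `[A_v, j]`, `v = dπ X`. As `dπ` maps the tangent space of `J(M)` onto that of `M`, the two
structures agree iff `[A_{jv}, j] = j [A_v, j]` for all points `j` of `J(M)` and all `v`
(`twistorStructure_eq_iff`).

Let `D` be the derivation action of `j` on `V* ⊗ V* ⊗ V`. It is a signed sum of three commuting
operators of square `-1`, so its complex eigenvalues lie among `±i` and `±3i`. Up to the factor
`-2`, `D² + 1` is the operator in the condition above, so the condition says that `A` has no part in
the eigenspaces for `±3i` (`thirdType_inFrame_eq_zero_iff`, `hasThreeIEigenvalue_iff`).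

All complex structures on `V` are conjugate, so letting `j` vary amounts to fixing `j₀` and letting
the frame vary (`twistorStructure_eq_iff_inFrame`). Frames at a point form one `GL(V)`-orbit, hence
`D² + 1` must vanish on the whole orbit of `A_x`. The tensors with this property form a
subrepresentation. It meets an irreducible `W_k` in `0` or in all of `W_k`, the latter exactly when
`3i` is not an eigenvalue on `W_k`. Since each `W_k` is stable under `D`, the condition can be
tested on each component separately (`forall_thirdType_tensorRep_eq_zero_iff`).

Decompositions exist because `GL(V)` is closed under transposition, so orthogonal complements of
subrepresentations are subrepresentations. -/

open Bundle Filter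
open scoped Manifold ContDiff Topology TensorProduct

noncomputable section

namespace Twistor

/-! ### Complete reducibility of `V* ⊗ V* ⊗ V` -/

section Semisimple

variable {V : Type*} [AddCommGroup V] [Module ℝ V]

/-- The adjoint of an endomorphism with respect to the scalar product that makes the basis `e`
orthonormal. -/
def basisAdjoint {ι : Type*} [Fintype ι] [DecidableEq ι] (e : Module.Basis ι ℝ V)
    (g : Module.End ℝ V) : Module.End ℝ V :=
  Matrix.toLin e e (LinearMap.toMatrix e e g).transpose

variable {ι : Type*} [Fintype ι] (e : Module.Basis ι ℝ V)

lemma basisAdjoint_mul [DecidableEq ι] (g h : Module.End ℝ V) :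
    basisAdjoint e (g * h) = basisAdjoint e h * basisAdjoint e g := by
  rw [basisAdjoint, LinearMap.toMatrix_mul, Matrix.transpose_mul, Matrix.toLin_mul e e e]
  rfl

lemma basisAdjoint_one [DecidableEq ι] : basisAdjoint e (1 : Module.End ℝ V) = 1 := by
  rw [basisAdjoint, LinearMap.toMatrix_one, Matrix.transpose_one, Matrix.toLin_one]
  rfl

lemma apply_basis_eq_sum [DecidableEq ι] (g : Module.End ℝ V) (i : ι) :
    g (e i) = ∑ k, LinearMap.toMatrix e e g k i • e k := by
  conv_lhs => rw [← Matrix.toLin_toMatrix e e g, Matrix.toLin_self]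

lemma basisAdjoint_basis [DecidableEq ι] (g : Module.End ℝ V) (k : ι) :
    basisAdjoint e g (e k) = ∑ i, LinearMap.toMatrix e e g k i • e i := by
  rw [basisAdjoint, Matrix.toLin_self]
  rfl

/-- Both sides are the sum of `g_{ki} φ(e_k, e_i)`. This moves an operator from the argument slots
of one tensor to those of another in `tensorForm`. -/
lemma sum_bilin_basisAdjoint [DecidableEq ι] (φ : V →ₗ[ℝ] V →ₗ[ℝ] ℝ) (g : Module.End ℝ V) :
    ∑ i, φ (g (e i)) (e i) = ∑ i, φ (e i) (basisAdjoint e g (e i)) := by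
  simp only [apply_basis_eq_sum e g, basisAdjoint_basis, map_sum, map_smul,
    LinearMap.sum_apply, LinearMap.smul_apply]
  exact Finset.sum_comm

/-- The scalar product on `V` that makes the basis `e` orthonormal. -/
def basisForm : V →ₗ[ℝ] V →ₗ[ℝ] ℝ :=
  ∑ i, (LinearMap.mul ℝ ℝ).compl₁₂ (e.coord i) (e.coord i)

lemma basisForm_apply (u v : V) : basisForm e u v = ∑ i, e.coord i u * e.coord i v := by
  simp [basisForm, LinearMap.sum_apply]

lemma basisForm_self_nonneg (u : V) : 0 ≤ basisForm e u u := by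
  rw [basisForm_apply]
  exact Finset.sum_nonneg fun i _ => mul_self_nonneg _

lemma eq_zero_of_basisForm_self (u : V) (h : basisForm e u u = 0) : u = 0 := by
  rw [basisForm_apply, Finset.sum_eq_zero_iff_of_nonneg fun i _ => mul_self_nonneg _] at h
  exact e.ext_elem fun i => by simpa using h i (Finset.mem_univ i)

lemma basisForm_basis [DecidableEq ι] (u : V) (i : ι) : basisForm e u (e i) = e.coord i u := by
  rw [basisForm_apply, Finset.sum_eq_single i]
  · simp
  · intro j _ hj
    simp [Finsupp.single_eq_of_ne hj]
  · simp

lemma basisForm_adjoint [DecidableEq ι] (g : Module.End ℝ V) (u v : V) :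
    basisForm e (g u) v = basisForm e u (basisAdjoint e g v) := by
  suffices h : (basisForm e).comp g = (basisForm e).compl₂ (basisAdjoint e g) from
    LinearMap.congr_fun₂ h u v
  refine e.ext fun i => e.ext fun j => ?_
  simp only [LinearMap.comp_apply, LinearMap.compl₂_apply, basisForm_basis]
  rw [apply_basis_eq_sum e g, basisAdjoint_basis]
  simp only [map_sum, map_smul, basisForm_basis]
  simp [Finsupp.single_apply]

/-- The scalar product on `V* ⊗ V* ⊗ V` defined by the basis `e` of `V`. -/
def tensorForm (S T : Tensors V) : ℝ := ∑ i, ∑ j, basisForm e (S (e i) (e j)) (T (e i) (e j))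

lemma tensorForm_add_left (S S' T : Tensors V) :
    tensorForm e (S + S') T = tensorForm e S T + tensorForm e S' T := by
  simp [tensorForm, Finset.sum_add_distrib]

lemma tensorForm_smul_left (c : ℝ) (S T : Tensors V) :
    tensorForm e (c • S) T = c * tensorForm e S T := by
  simp [tensorForm, Finset.mul_sum]

lemma tensorForm_add_right (S T T' : Tensors V) :
    tensorForm e S (T + T') = tensorForm e S T + tensorForm e S T' := by
  simp [tensorForm, Finset.sum_add_distrib]

lemma tensorForm_smul_right (c : ℝ) (S T : Tensors V) :
    tensorForm e S (c • T) = c * tensorForm e S T := by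
  simp [tensorForm, Finset.mul_sum]

/-- `tensorForm` as a bilinear form. -/
def tensorBilin : LinearMap.BilinForm ℝ (Tensors V) :=
  LinearMap.mk₂ ℝ (tensorForm e) (tensorForm_add_left e) (tensorForm_smul_left e)
    (tensorForm_add_right e) (tensorForm_smul_right e)

lemma eq_zero_of_tensorForm_self (T : Tensors V) (h : tensorForm e T T = 0) : T = 0 := by
  have h1 : ∀ i j, 0 ≤ basisForm e (T (e i) (e j)) (T (e i) (e j)) :=
    fun i j => basisForm_self_nonneg e _
  rw [tensorForm, Finset.sum_eq_zero_iff_of_nonneg fun i _ => Finset.sum_nonneg fun j _ => h1 i j]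
    at h
  refine e.ext fun i => e.ext fun j => ?_
  have h2 := h i (Finset.mem_univ i)
  rw [Finset.sum_eq_zero_iff_of_nonneg fun j _ => h1 i j] at h2
  exact eq_zero_of_basisForm_self e _ (h2 j (Finset.mem_univ j))

lemma tensorForm_comm (S T : Tensors V) : tensorForm e S T = tensorForm e T S := by
  simp only [tensorForm, basisForm_apply, mul_comm]

/-- The adjoint of an invertible endomorphism. -/
def glAdjoint [DecidableEq ι] (g : LinearMap.GeneralLinearGroup ℝ V) : LinearMap.GeneralLinearGroup ℝ V where
  val := basisAdjoint e g.val
  inv := basisAdjoint e g⁻¹.val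
  val_inv := by rw [← basisAdjoint_mul, ← Units.val_mul, inv_mul_cancel, Units.val_one,
    basisAdjoint_one]
  inv_val := by rw [← basisAdjoint_mul, ← Units.val_mul, mul_inv_cancel, Units.val_one,
    basisAdjoint_one]

/-- The adjoint of the action of `g` is the action of its transpose: `g` on the values moves across
by `basisForm_adjoint`, and `g⁻¹` on each of the two arguments by `sum_bilin_basisAdjoint`. -/
lemma tensorForm_tensorRep [DecidableEq ι] (g : LinearMap.GeneralLinearGroup ℝ V) (S T : Tensors V) :
    tensorForm e (tensorRep V g S) T = tensorForm e S (tensorRep V (glAdjoint e g) T) := by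
  have hv : (glAdjoint e g).val = basisAdjoint e g.val := rfl
  have hi : (glAdjoint e g)⁻¹.val = basisAdjoint e g⁻¹.val := rfl
  have ha := basisForm_adjoint e g.val
  simp only [tensorForm, tensorRep_apply, ha, hv, hi]
  -- The inner sum frees the second argument of `S` from `g⁻¹`; once the sums are exchanged, the
  -- same identity frees the first.
  have h1 : ∀ i, ∑ j, basisForm e (S (g⁻¹.val (e i)) (g⁻¹.val (e j)))
      (basisAdjoint e g.val (T (e i) (e j))) =
      ∑ j, basisForm e (S (g⁻¹.val (e i)) (e j))
      (basisAdjoint e g.val (T (e i) (basisAdjoint e g⁻¹.val (e j)))) := fun i =>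
    sum_bilin_basisAdjoint e ((basisForm e).compl₁₂ (S (g⁻¹.val (e i)))
      (basisAdjoint e g.val ∘ₗ T (e i))) g⁻¹.val
  rw [Finset.sum_congr rfl fun i _ => h1 i, Finset.sum_comm]
  conv_rhs => rw [Finset.sum_comm]
  refine Finset.sum_congr rfl fun j _ => ?_
  exact sum_bilin_basisAdjoint e ((basisForm e).compl₁₂ (S.flip (e j))
      (basisAdjoint e g.val ∘ₗ T.flip (basisAdjoint e g⁻¹.val (e j)))) g⁻¹.val

variable (V) in
/-- The representation of `GL(V)` on `V* ⊗ V* ⊗ V` is semisimple. -/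
theorem isSemisimpleRepresentation_tensorRep [FiniteDimensional ℝ V] :
    Representation.IsSemisimpleRepresentation (tensorRep V) := by
  refine ⟨fun W => ?_⟩
  set e := Module.finBasis ℝ V
  -- The orthogonal complement is stable under `g` because `W` is stable under the transpose of `g`,
  -- again an element of `GL(V)`.
  let W' : Subrepresentation (tensorRep V) :=
    { toSubmodule := (tensorBilin e).orthogonal W.toSubmodule
      apply_mem_toSubmodule := fun g T hT S hS => by
        change tensorForm e S (tensorRep V g T) = 0
        rw [tensorForm_comm, tensorForm_tensorRep, tensorForm_comm]
        exact hT _ (W.apply_mem_toSubmodule _ hS) }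
  have hrefl : (tensorBilin e).IsRefl := fun S T h => (tensorForm_comm e T S).trans h
  have hdis : Disjoint W.toSubmodule W'.toSubmodule := by
    rw [Submodule.disjoint_def]
    exact fun T h1 h2 => eq_zero_of_tensorForm_self e T (h2 T h1)
  have hcompl : IsCompl W.toSubmodule W'.toSubmodule :=
    (LinearMap.BilinForm.isCompl_orthogonal_iff_disjoint hrefl).2 hdis
  refine ⟨W', ?_⟩
  rw [isCompl_iff, disjoint_iff, codisjoint_iff]
  exact ⟨Subrepresentation.toSubmodule_injective hcompl.inf_eq_bot,
    Subrepresentation.toSubmodule_injective hcompl.sup_eq_top⟩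

/-- Subrepresentations of `σ` embed into the subrepresentations of `ρ` below `σ`, and below an atom
there are only `⊥` and `σ`. -/
lemma isIrreducible_toRepresentation_of_isAtom {k G W : Type*} [Field k] [Monoid G]
    [AddCommGroup W] [Module k W] {ρ : Representation k G W} {σ : Subrepresentation ρ}
    (hσ : IsAtom σ) : Representation.IsIrreducible σ.toRepresentation := by
  let m : Subrepresentation σ.toRepresentation → Subrepresentation ρ := fun τ =>
    { toSubmodule := τ.toSubmodule.map σ.toSubmodule.subtype
      apply_mem_toSubmodule := by
        rintro g _ ⟨w, hw, rfl⟩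
        exact ⟨_, τ.apply_mem_toSubmodule g hw, rfl⟩ }
  have hm : Function.Injective m := fun τ τ' h =>
    Subrepresentation.toSubmodule_injective (Submodule.map_injective_of_injective
      σ.toSubmodule.injective_subtype (congrArg Subrepresentation.toSubmodule h))
  have hbot : m ⊥ = ⊥ := Subrepresentation.toSubmodule_injective (Submodule.map_bot _)
  have htop : m ⊤ = σ := Subrepresentation.toSubmodule_injective (Submodule.map_subtype_top _)
  have hle : ∀ τ, m τ ≤ σ := fun τ => Submodule.map_subtype_le σ.toSubmodule τ.toSubmodule
  refine { exists_pair_ne := ⟨⊥, ⊤, fun h => hσ.1 ?_⟩, eq_bot_or_eq_top := fun τ => ?_ }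
  · rw [← htop, ← h, hbot]
  · exact (hσ.le_iff.1 (hle τ)).imp (fun h => hm (h.trans hbot.symm))
      fun h => hm (h.trans htop.symm)

open scoped MonoidAlgebra in
variable (V) in
/-- `V* ⊗ V* ⊗ V` is a finite direct sum of irreducible subrepresentations. -/
theorem exists_irreducibleDecomposition [FiniteDimensional ℝ V] :
    ∃ k, Nonempty (IrreducibleDecomposition V k) := by
  have hss := (Representation.isSemisimpleRepresentation_iff_isSemisimpleModule_asModule _).1
    (isSemisimpleRepresentation_tensorRep V)
  obtain ⟨s, hind, hsup, hs⟩ := IsSemisimpleModule.exists_sSupIndep_sSup_simples_eq_top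
    (ℝ[LinearMap.GeneralLinearGroup ℝ V]) (tensorRep V).asModule
  -- Finite dimension gives the ascending chain condition, which forces the independent family of
  -- simple submodules to be finite.
  have hwf : WellFoundedGT (Subrepresentation (tensorRep V)) :=
    StrictMono.wellFoundedGT (f := Subrepresentation.toSubmodule) fun _ _ h => h
  have hwf' : WellFoundedGT (Submodule (ℝ[LinearMap.GeneralLinearGroup ℝ V])
      (tensorRep V).asModule) :=
    (Subrepresentation.subrepresentationSubmoduleOrderIso (ρ := tensorRep V)).symm.strictMono.wellFoundedGT
  have hfin : Finite s := WellFoundedGT.finite_of_sSupIndep hind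
  have f : Fin (Nat.card s) ≃ s := (Finite.equivFin s).symm
  refine ⟨Nat.card s, ⟨fun i => Subrepresentation.ofSubmodule' (f i).1, fun i => ?_, ?_⟩⟩
  · have h : IsAtom (f i).1 := by
      have := hs _ (f i).2
      exact (isSimpleModule_iff_isAtom (R := ℝ[LinearMap.GeneralLinearGroup ℝ V])
        (M := (tensorRep V).asModule) (m := (f i).1)).1 this
    exact isIrreducible_toRepresentation_of_isAtom
      (((Subrepresentation.subrepresentationSubmoduleOrderIso
        (ρ := tensorRep V)).symm.isAtom_iff _).2 h)
  · have h1 : iSupIndep fun i => (f i).1 := ((sSupIndep_iff s).1 hind).comp f.injective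
    have h2 : ⨆ i, (f i).1 = ⊤ := by
      rw [← hsup, sSup_eq_iSup', f.iSup_comp (g := fun x : s => x.1)]
    have h3 := DirectSum.isInternal_submodule_of_iSupIndep_of_iSup_eq_top
      (R := ℝ[LinearMap.GeneralLinearGroup ℝ V]) (M := (tensorRep V).asModule) h1 h2
    -- Over the group algebra and over `ℝ`, being internal is bijectivity of the same summation map.
    exact h3

end Semisimple

/-! ### Conjugacy of complex structures -/

section ComplexStructures

/-- The algebra map from `ℂ` to the real endomorphisms that sends `i` to `j` turns `V` into a
complex vector space. -/
lemma exists_complexModule {V : Type*} [AddCommGroup V] [Module ℝ V] (j : V →ₗ[ℝ] V)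
    (hj : ∀ u, j (j u) = -u) :
    ∃ m : Module ℂ V, IsScalarTower ℝ ℂ V ∧ ∀ u, m.smul Complex.I u = j u := by
  have hjj : j * j = -1 := by ext u; exact hj u
  let f : ℂ →ₐ[ℝ] Module.End ℝ V := Complex.lift ⟨j, hjj⟩
  let m : Module ℂ V := Module.compHom V f.toRingHom
  refine ⟨m, ⟨fun a z u => ?_⟩, fun u => ?_⟩
  · change f (a • z) u = a • f z u
    rw [map_smul]
    rfl
  · change f Complex.I u = j u
    rw [show f Complex.I = j from Complex.liftAux_apply_I j hjj]

/-- Two complex structures on vector spaces of the same dimension are isomorphic. -/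
lemma exists_linearEquiv_comm {V V' : Type*} [AddCommGroup V] [Module ℝ V] [AddCommGroup V']
    [Module ℝ V'] [FiniteDimensional ℝ V] [FiniteDimensional ℝ V']
    (h : Module.finrank ℝ V = Module.finrank ℝ V') (j : V →ₗ[ℝ] V) (j' : V' →ₗ[ℝ] V')
    (hj : ∀ u, j (j u) = -u) (hj' : ∀ u, j' (j' u) = -u) :
    ∃ b : V ≃ₗ[ℝ] V', ∀ u, b (j u) = j' (b u) := by
  obtain ⟨m, hm, hI⟩ := exists_complexModule j hj
  obtain ⟨m', hm', hI'⟩ := exists_complexModule j' hj'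
  have : Module.Finite ℂ V := Module.Finite.right ℝ ℂ V
  have : Module.Finite ℂ V' := Module.Finite.right ℝ ℂ V'
  have h1 := Module.finrank_mul_finrank ℝ ℂ V
  have h2 := Module.finrank_mul_finrank ℝ ℂ V'
  rw [Complex.finrank_real_complex] at h1 h2
  -- The complex dimensions are half the real ones, hence equal; complex linearity of `b` is the
  -- intertwining property.
  let b : V ≃ₗ[ℂ] V' := LinearEquiv.ofFinrankEq V V' (by omega)
  refine ⟨b.restrictScalars ℝ, fun u => ?_⟩
  have h3 := b.map_smul Complex.I u
  exact (congrArg b (hI u)).symm.trans (h3.trans (hI' (b u)))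

end ComplexStructures

/-! ### The operator `D² + 1` and the eigenvalue `3i` -/

section Eigenvalue

variable {V : Type*} [AddCommGroup V] [Module ℝ V]

/-- The operator `D² + 1` on `V* ⊗ V* ⊗ V`, with `D` the action of `j`. For `j² = -1` its kernel
is the complement of the eigenspaces of `D` for `±3i`. -/
def thirdType (j : V →ₗ[ℝ] V) : Module.End ℝ (Tensors V) := glAction j * glAction j + 1

lemma thirdType_apply (j : V →ₗ[ℝ] V) (T : Tensors V) :
    thirdType j T = glAction j (glAction j T) + T := rfl

/-- Write `D = a - b - c`, where `a`, `b`, `c` let `j` act on the value and on the two arguments.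
They commute and have square `-1`, so `D² + 1 = -2 (1 + ab + ac - bc)`. -/
lemma thirdType_apply_apply (j : V →ₗ[ℝ] V) (hj : ∀ u, j (j u) = -u) (T : Tensors V) (u v : V) :
    thirdType j T u v =
      (-2 : ℝ) • (T u v + j (T u (j v)) - T (j u) (j v) + j (T (j u) v)) := by
  simp only [thirdType_apply, LinearMap.add_apply, glAction_apply, map_sub, hj, map_neg,
    LinearMap.neg_apply]
  module

lemma thirdType_eq_zero_iff (j : V →ₗ[ℝ] V) (hj : ∀ u, j (j u) = -u) (T : Tensors V) :
    thirdType j T = 0 ↔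
      ∀ u v, T u v + j (T u (j v)) - T (j u) (j v) + j (T (j u) v) = 0 := by
  constructor
  · intro h u v
    have h1 := LinearMap.congr_fun₂ h u v
    rw [thirdType_apply_apply j hj, LinearMap.zero_apply, LinearMap.zero_apply] at h1
    exact (smul_eq_zero.1 h1).resolve_left (by norm_num)
  · intro h
    ext u v
    rw [thirdType_apply_apply j hj, h, smul_zero]
    rfl

/-- This is `(D² + 9)(D² + 1) = 0`: the eigenvalues of `D` are `±i` and `±3i`, and the image of `D²
+ 1` belongs to `±3i`. -/
lemma glAction_glAction_thirdType (j : V →ₗ[ℝ] V) (hj : ∀ u, j (j u) = -u) (T : Tensors V) :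
    glAction j (glAction j (thirdType j T)) = (-9 : ℝ) • thirdType j T := by
  ext u v
  simp only [LinearMap.smul_apply, glAction_apply, thirdType_apply_apply j hj, map_sub, hj,
    map_neg, LinearMap.neg_apply, map_smul, map_add]
  module

/-- A complex structure as an element of `GL(V)`. -/
def complexUnit (j : V →ₗ[ℝ] V) (hj : ∀ u, j (j u) = -u) : LinearMap.GeneralLinearGroup ℝ V where
  val := j
  inv := -j
  val_inv := by ext u; simp [hj]
  inv_val := by ext u; simp [hj]

/-- `1 + j` as an element of `GL(V)`. -/
def oneAddUnit (j : V →ₗ[ℝ] V) (hj : ∀ u, j (j u) = -u) : LinearMap.GeneralLinearGroup ℝ V where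
  val := 1 + j
  inv := (1 / 2 : ℝ) • (1 - j)
  val_inv := by
    ext u
    simp only [Module.End.mul_apply, LinearMap.add_apply, LinearMap.smul_apply,
      LinearMap.sub_apply, Module.End.one_apply, map_smul, map_sub, hj]
    module
  inv_val := by
    ext u
    simp only [Module.End.mul_apply, LinearMap.add_apply, LinearMap.smul_apply,
      LinearMap.sub_apply, Module.End.one_apply, map_add, hj]
    module

/-- The derivative action of `j` as a combination of elements of `GL(V)`. -/
lemma glAction_eq_tensorRep (j : V →ₗ[ℝ] V) (hj : ∀ u, j (j u) = -u)
    (hj' : ∀ u, (-j) ((-j) u) = -u) :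
    glAction j = (2 : ℝ) • (tensorRep V (oneAddUnit j hj) - tensorRep V (oneAddUnit (-j) hj'))
      - tensorRep V (complexUnit j hj) := by
  have h1 : (oneAddUnit j hj).val = 1 + j := rfl
  have h2 : (oneAddUnit j hj)⁻¹.val = (1 / 2 : ℝ) • (1 - j) := rfl
  have h3 : (oneAddUnit (-j) hj').val = 1 + -j := rfl
  have h4 : (oneAddUnit (-j) hj')⁻¹.val = (1 / 2 : ℝ) • (1 - -j) := rfl
  have h5 : (complexUnit j hj).val = j := rfl
  have h6 : (complexUnit j hj)⁻¹.val = -j := rfl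
  ext T u v
  simp only [LinearMap.sub_apply, LinearMap.smul_apply, tensorRep_apply, glAction_apply,
    h1, h2, h3, h4, h5, h6, LinearMap.add_apply, LinearMap.neg_apply, Module.End.one_apply,
    map_smul, map_sub, map_neg]
  module

/-- Subrepresentations are stable under the Lie algebra. For a complex structure no differentiation
is needed, since `D` is a linear combination of the actions of `1 + j`, `1 - j` and `j`. -/
lemma glAction_mem (j : V →ₗ[ℝ] V) (hj : ∀ u, j (j u) = -u)
    (W : Subrepresentation (tensorRep V)) {T : Tensors V} (hT : T ∈ W.toSubmodule) :
    glAction j T ∈ W.toSubmodule := by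
  rw [glAction_eq_tensorRep j hj (by simpa using hj)]
  exact W.toSubmodule.sub_mem (W.toSubmodule.smul_mem _ (W.toSubmodule.sub_mem
    (W.apply_mem_toSubmodule _ hT) (W.apply_mem_toSubmodule _ hT))) (W.apply_mem_toSubmodule _ hT)

lemma thirdType_mem (j : V →ₗ[ℝ] V) (hj : ∀ u, j (j u) = -u)
    (W : Subrepresentation (tensorRep V)) {T : Tensors V} (hT : T ∈ W.toSubmodule) :
    thirdType j T ∈ W.toSubmodule :=
  W.toSubmodule.add_mem (glAction_mem j hj W (glAction_mem j hj W hT)) hT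

/-- This replaces the complex eigenvalue condition by a real one: `D² + 1` acts by `-8` on the
eigenspace for `3i`, and a nonzero value of `D² + 1` produces an eigenvector. -/
lemma hasThreeIEigenvalue_iff (j : V →ₗ[ℝ] V) (hj : ∀ u, j (j u) = -u)
    (W : Subrepresentation (tensorRep V)) :
    HasThreeIEigenvalue j W.toSubmodule ↔ ∃ T ∈ W.toSubmodule, thirdType j T ≠ 0 := by
  constructor
  · rintro ⟨w, hw, hev⟩
    by_contra! h
    have h1 : ∀ w ∈ W.toSubmodule.baseChange ℂ, (thirdType j).baseChange ℂ w = 0 := by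
      intro w hw
      rw [Submodule.baseChange_eq_span] at hw
      induction hw using Submodule.span_induction with
      | mem w hw =>
        obtain ⟨T, hT, rfl⟩ := hw
        simp [h T hT]
      | zero => simp
      | add _ _ _ _ h1 h2 => rw [map_add, h1, h2, add_zero]
      | smul c _ _ h => rw [map_smul, h, smul_zero]
    have h2 := h1 w hw
    have h3 : (glAction j).baseChange ℂ w = (3 * Complex.I) • w :=
      Module.End.mem_eigenspace_iff.1 hev.1
    rw [thirdType, LinearMap.baseChange_add, LinearMap.baseChange_mul, LinearMap.baseChange_one,
      LinearMap.add_apply, Module.End.mul_apply, h3, map_smul, h3, smul_smul, Module.End.one_apply] at h2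
    -- The scalar is `-9 + 1 = -8`, so the eigenvector would vanish.
    replace h2 : ((3 * Complex.I) * (3 * Complex.I) + 1) • w = 0 := by
      rw [add_smul, one_smul, h2]
    rw [smul_eq_zero] at h2
    refine h2.elim (fun h => ?_) hev.2
    have h4 : (3 * Complex.I) * (3 * Complex.I) = -9 := by
      linear_combination 9 * Complex.I_mul_I
    rw [h4] at h
    norm_num at h
  · rintro ⟨T, hT, hne⟩
    set S := thirdType j T with hS
    have hSW : S ∈ W.toSubmodule := thirdType_mem j hj W hT
    -- Since `D² S = -9 S`, the vector `(D + 3i) S` is killed by `D - 3i`.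
    refine ⟨(1 : ℂ) ⊗ₜ glAction j S + (3 * Complex.I) ⊗ₜ S, ?_, ?_, ?_⟩
    · exact Submodule.add_mem _ (Submodule.tmul_mem_baseChange_of_mem _ (glAction_mem j hj W hSW))
        (Submodule.tmul_mem_baseChange_of_mem _ hSW)
    · rw [Module.End.mem_eigenspace_iff, map_add, LinearMap.baseChange_tmul,
        LinearMap.baseChange_tmul, hS, glAction_glAction_thirdType j hj, smul_add,
        TensorProduct.smul_tmul', TensorProduct.smul_tmul', smul_eq_mul, smul_eq_mul, mul_one,
        ← TensorProduct.smul_tmul, add_comm]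
      congr 2
      rw [Complex.real_smul]
      push_cast
      linear_combination -9 * Complex.I_mul_I
    · intro h
      -- The imaginary part of the vector is `3 S`, which is not zero.
      have h1 := congrArg (LinearMap.lTensor (Tensors V) Complex.imLm ∘ₗ
        (TensorProduct.comm ℝ ℂ (Tensors V)).toLinearMap) h
      have h2 := congrArg (TensorProduct.rid ℝ (Tensors V)) h1
      simp at h2
      exact hne h2

end Eigenvalue

/-! ### Irreducible components and orbits -/

section Decomposition

variable {V : Type*} [AddCommGroup V] [Module ℝ V] {k : ℕ} (D : IrreducibleDecomposition V k)

lemma IrreducibleDecomposition.sum_proj (T : Tensors V) :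
    ∑ i, (D.proj i T : Tensors V) = T := by
  set e := LinearEquiv.ofBijective
    (DirectSum.coeLinearMap fun i => (D.summand i).toSubmodule) D.isInternal
  have h : e (e.symm T) = T := e.apply_symm_apply T
  refine Eq.trans ?_ h
  classical
  refine Eq.symm ((DirectSum.coeLinearMap_eq_dfinsuppSum _ _).trans ?_)
  rw [DFinsupp.sum_eq_sum_fintype _ fun _ => rfl]
  rfl

lemma IrreducibleDecomposition.proj_eq_of_sum (x : ∀ i, (D.summand i).toSubmodule) (i : Fin k) :
    D.proj i (∑ l, (x l : Tensors V)) = x i := by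
  have h : ∀ l, D.proj i (x l : Tensors V) = if h : l = i then h ▸ x l else 0 := by
    intro l
    split_ifs with h
    · subst h
      exact D.isInternal.ofBijective_coeLinearMap_same (x l)
    · exact D.isInternal.ofBijective_coeLinearMap_of_ne h (x l)
  rw [map_sum, Finset.sum_congr rfl fun l _ => h l]
  simp

/-- Applying `f` to the sum of the components of `T` gives a decomposition of `f T`, and
decompositions are unique. Only stability of the summands matters, so `f` need not be equivariant.
-/
lemma IrreducibleDecomposition.proj_apply_of_invariant (f : Module.End ℝ (Tensors V))
    (hf : ∀ i, ∀ T ∈ (D.summand i).toSubmodule, f T ∈ (D.summand i).toSubmodule)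
    (i : Fin k) (T : Tensors V) : (D.proj i (f T) : Tensors V) = f (D.proj i T) := by
  have h := D.proj_eq_of_sum (fun l => ⟨f (D.proj l T), hf l _ (D.proj l T).2⟩) i
  have h1 : ∑ l, f (D.proj l T) = f T := by rw [← map_sum, D.sum_proj]
  rw [← h1]
  exact congrArg Subtype.val h

/-- The operator `thirdType` vanishes on the orbit of `T` if and only if `T` has no component in
an irreducible summand on which `j` has the eigenvalue `3i`. -/
theorem IrreducibleDecomposition.forall_thirdType_tensorRep_eq_zero_iff (j : V →ₗ[ℝ] V)
    (hj : ∀ u, j (j u) = -u) (T : Tensors V) :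
    (∀ g, thirdType j (tensorRep V g T) = 0) ↔
      ∀ i, HasThreeIEigenvalue j (D.summand i).toSubmodule → D.proj i T = 0 := by
  constructor
  · intro h i hi
    by_contra hne
    obtain ⟨S, hS, hS0⟩ := (hasThreeIEigenvalue_iff j hj _).1 hi
    -- `N` consists of the vectors of the summand whose whole orbit is killed by `thirdType j`. It
    -- contains the component of `T` but, by its value at `g = 1`, not `S`; irreducibility then
    -- leaves only `N = 0`.
    let N : Subrepresentation (D.summand i).toRepresentation :=
      { toSubmodule := ⨅ g, LinearMap.ker (thirdType j ∘ₗ tensorRep V g ∘ₗ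
          (D.summand i).toSubmodule.subtype)
        apply_mem_toSubmodule := fun g w hw => by
          rw [Submodule.mem_iInf] at hw ⊢
          intro g'
          have := hw (g' * g)
          rw [LinearMap.mem_ker, LinearMap.comp_apply, LinearMap.comp_apply, map_mul] at this
          exact this }
    have hN : D.proj i T ∈ N.toSubmodule := by
      rw [Submodule.mem_iInf]
      intro g
      have h1 := D.proj_apply_of_invariant (thirdType j * tensorRep V g)
        (fun l T hT => thirdType_mem j hj _ ((D.summand l).apply_mem_toSubmodule g hT)) i T
      rw [Module.End.mul_apply, h g, map_zero] at h1
      exact h1.symm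
    have := D.irreducible i
    rcases eq_bot_or_eq_top N with hb | ht
    · rw [hb] at hN
      exact hne hN
    · have h1 : (⟨S, hS⟩ : (D.summand i).toSubmodule) ∈ N.toSubmodule := by rw [ht]; trivial
      rw [Submodule.mem_iInf] at h1
      have h2 := h1 1
      rw [map_one] at h2
      exact hS0 h2
  · intro h g
    rw [← D.sum_proj T, map_sum, map_sum]
    refine Finset.sum_eq_zero fun i _ => ?_
    by_cases hi : HasThreeIEigenvalue j (D.summand i).toSubmodule
    · rw [h i hi]; simp
    · rw [hasThreeIEigenvalue_iff j hj] at hi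
      push Not at hi
      exact hi _ ((D.summand i).apply_mem_toSubmodule g (D.proj i T).2)

end Decomposition

/-! ### Comparison of the structures of `∇` and `∇ + A` -/

section Comparison

variable {E : Type*} [NormedAddCommGroup E] [NormedSpace ℝ E]
  {M : Type*} [TopologicalSpace M] [ChartedSpace E M] [IsManifold 𝓘(ℝ, E) ∞ M]
  {cov cov' : CovariantDerivative 𝓘(ℝ, E) E (TangentSpace 𝓘(ℝ, E) : M → Type _)}
  {A : ∀ x : M, TangentSpace 𝓘(ℝ, E) x →L[ℝ] TangentSpace 𝓘(ℝ, E) x →L[ℝ]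
      TangentSpace 𝓘(ℝ, E) x}

/-- The covariant differentials of `𝒥` for `∇` and `∇ + A` differ by `[A, 𝒥]`. -/
lemma covDiffJ_eq_add
    (hA : ∀ (Y : ∀ x : M, TangentSpace 𝓘(ℝ, E) x) (x : M),
      MDifferentiableAt 𝓘(ℝ, E) (𝓘(ℝ, E).prod 𝓘(ℝ, E))
        (fun y => (⟨y, Y y⟩ : TangentBundle 𝓘(ℝ, E) M)) x →
      ∀ X : TangentSpace 𝓘(ℝ, E) x, cov' Y x X = cov Y x X + A x X (Y x))
    (p : EndTotal E M) (X : TangentSpace (EndModel E) p) (u : TangentSpace 𝓘(ℝ, E) p.1) :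
    covDiffJ cov' p X u = covDiffJ cov p X u +
      (A p.1 (dProj p X) (p.2 u) - p.2 (A p.1 (dProj p X) u)) := by
  -- Only the local extensions of `u` and `j u` are differentiated; they are differentiable at the
  -- point, so `hA` applies to them.
  rw [covDiffJ_eq, covDiffJ_eq, hA _ _ (FiberBundle.mdifferentiableAt_extend ..),
    hA _ _ (FiberBundle.mdifferentiableAt_extend ..), FiberBundle.extend_apply_self,
    FiberBundle.extend_apply_self, map_add]
  abel

variable [FiniteDimensional ℝ E]

/-- `J^∇ = J^{∇ + A}` if and only if `[A_{j v}, j] = j [A_v, j]` for all complex structures `j`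
and all `v`. -/
theorem twistorStructure_eq_iff
    (hA : ∀ (Y : ∀ x : M, TangentSpace 𝓘(ℝ, E) x) (x : M),
      MDifferentiableAt 𝓘(ℝ, E) (𝓘(ℝ, E).prod 𝓘(ℝ, E))
        (fun y => (⟨y, Y y⟩ : TangentBundle 𝓘(ℝ, E) M)) x →
      ∀ X : TangentSpace 𝓘(ℝ, E) x, cov' Y x X = cov Y x X + A x X (Y x)) :
    twistorStructure cov = twistorStructure cov' ↔
      ∀ p ∈ JBundle E M, ∀ v u : TangentSpace 𝓘(ℝ, E) p.1,
        A p.1 v u + p.2 (A p.1 v (p.2 u)) - A p.1 (p.2 v) (p.2 u) + p.2 (A p.1 (p.2 v) u) = 0 := by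
  constructor
  · intro h p hp v u
    -- Every `v` lifts to `J(M)`: in the coordinates at `p` the vector `(v, 0)` is tangent, as the
    -- zero fibre part anticommutes with `j`.
    obtain ⟨X, hX⟩ : ∃ X : JTangent p, dProj p X.1 = v :=
      ⟨⟨_, mem_JTangent_of_anticomm p hp v 0 fun w =>
        (zero_add _).trans (map_zero (show E →L[ℝ] E from p.2))⟩, dProj_eq p _⟩
    obtain ⟨h1, h2⟩ := isTwistorStructure_twistorStructure cov ⟨p, hp⟩ X
    have h3 := (isTwistorStructure_twistorStructure cov' ⟨p, hp⟩ X).2 u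
    rw [← h, covDiffJ_eq_add hA, covDiffJ_eq_add hA, h2, map_add, add_right_inj, h1, hX, map_sub,
      hp] at h3
    rw [← sub_eq_zero] at h3
    rw [← neg_eq_zero, ← h3]
    abel
  · intro h
    -- By uniqueness it suffices that `J^∇` satisfies the equations that define `J^{∇'}`.
    refine (existsUnique_isTwistorStructure cov').unique (fun p X => ?_)
      (isTwistorStructure_twistorStructure cov')
    obtain ⟨h1, h2⟩ := isTwistorStructure_twistorStructure cov p X
    refine ⟨h1, fun u => ?_⟩
    rw [covDiffJ_eq_add hA, covDiffJ_eq_add hA, h2, map_add, add_right_inj, h1, map_sub, p.2,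
      ← sub_eq_zero, ← neg_eq_zero, ← h p.1 p.2 (dProj p.1 X.1) u]
    abel

end Comparison

/-! ### From points of `J(M)` to frames -/

section Frames

variable {E : Type*} [NormedAddCommGroup E] [NormedSpace ℝ E]
  {M : Type*} [TopologicalSpace M] [ChartedSpace E M]

lemma inFrame_apply {x : M} (b : E ≃ₗ[ℝ] TangentSpace 𝓘(ℝ, E) x)
    (T : TangentSpace 𝓘(ℝ, E) x →L[ℝ] TangentSpace 𝓘(ℝ, E) x →L[ℝ] TangentSpace 𝓘(ℝ, E) x)
    (u v : E) : inFrame b T u v = b.symm (T (b u) (b v)) := rfl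

/-- The group acts on frames by `b ↦ b ∘ g⁻¹`, so the coordinates of one tensor in all frames form a
union of orbits. -/
lemma tensorRep_inFrame {x : M} (b : E ≃ₗ[ℝ] TangentSpace 𝓘(ℝ, E) x)
    (T : TangentSpace 𝓘(ℝ, E) x →L[ℝ] TangentSpace 𝓘(ℝ, E) x →L[ℝ] TangentSpace 𝓘(ℝ, E) x)
    (g : LinearMap.GeneralLinearGroup ℝ E) :
    tensorRep E g (inFrame b T) =
      inFrame ((LinearMap.GeneralLinearGroup.generalLinearEquiv ℝ E g).symm.trans b) T :=
  rfl

/-- In a frame that intertwines `j₀` and `j`, the operator `thirdType j₀` vanishes on `T` if and only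
if `[T_{j v}, j] = j [T_v, j]` for all `v`. -/
lemma thirdType_inFrame_eq_zero_iff {x : M} (b : E ≃ₗ[ℝ] TangentSpace 𝓘(ℝ, E) x)
    (T : TangentSpace 𝓘(ℝ, E) x →L[ℝ] TangentSpace 𝓘(ℝ, E) x →L[ℝ] TangentSpace 𝓘(ℝ, E) x)
    (j₀ : E →ₗ[ℝ] E) (hj₀ : ∀ u, j₀ (j₀ u) = -u)
    (j : TangentSpace 𝓘(ℝ, E) x →L[ℝ] TangentSpace 𝓘(ℝ, E) x) (hb : ∀ u, b (j₀ u) = j (b u)) :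
    thirdType j₀ (inFrame b T) = 0 ↔
      ∀ v u, T v u + j (T v (j u)) - T (j v) (j u) + j (T (j v) u) = 0 := by
  have hb' : ∀ u, j₀ (b.symm u) = b.symm (j u) := fun u => by
    rw [b.eq_symm_apply, hb, b.apply_symm_apply]
  rw [thirdType_eq_zero_iff j₀ hj₀]
  simp only [inFrame_apply, hb, hb', ← map_add, ← map_sub, LinearEquiv.map_eq_zero_iff]
  constructor
  · intro h v u
    simpa using h (b.symm v) (b.symm u)
  · exact fun h u v => h (b u) (b v)

variable [IsManifold 𝓘(ℝ, E) ∞ M] [FiniteDimensional ℝ E]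

/-- `J^∇ = J^{∇ + A}` if and only if `thirdType j₀` vanishes on `A` in all frames. -/
theorem twistorStructure_eq_iff_inFrame
    {cov cov' : CovariantDerivative 𝓘(ℝ, E) E (TangentSpace 𝓘(ℝ, E) : M → Type _)}
    {A : ∀ x : M, TangentSpace 𝓘(ℝ, E) x →L[ℝ] TangentSpace 𝓘(ℝ, E) x →L[ℝ]
      TangentSpace 𝓘(ℝ, E) x}
    (hA : ∀ (Y : ∀ x : M, TangentSpace 𝓘(ℝ, E) x) (x : M),
      MDifferentiableAt 𝓘(ℝ, E) (𝓘(ℝ, E).prod 𝓘(ℝ, E))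
        (fun y => (⟨y, Y y⟩ : TangentBundle 𝓘(ℝ, E) M)) x →
      ∀ X : TangentSpace 𝓘(ℝ, E) x, cov' Y x X = cov Y x X + A x X (Y x))
    (j₀ : E →ₗ[ℝ] E) (hj₀ : ∀ u, j₀ (j₀ u) = -u) :
    twistorStructure cov = twistorStructure cov' ↔
      ∀ (x : M) (b : E ≃ₗ[ℝ] TangentSpace 𝓘(ℝ, E) x), thirdType j₀ (inFrame b (A x)) = 0 := by
  rw [twistorStructure_eq_iff hA]
  have hfin : ∀ x : M, FiniteDimensional ℝ (TangentSpace 𝓘(ℝ, E) x) := fun x =>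
    inferInstanceAs (FiniteDimensional ℝ E)
  have ht2 : ∀ x : M, T2Space (TangentSpace 𝓘(ℝ, E) x) := fun x => inferInstanceAs (T2Space E)
  have ht2 : ∀ x : M, T2Space (TangentSpace 𝓘(ℝ, E) x) := fun x => inferInstanceAs (T2Space E)
  constructor
  · intro h x b
    -- The frame transports `j₀` to a point `b j₀ b⁻¹` of `J(M)` over `x`.
    let j : TangentSpace 𝓘(ℝ, E) x →L[ℝ] TangentSpace 𝓘(ℝ, E) x :=
      LinearMap.toContinuousLinearMap (b.toLinearMap ∘ₗ j₀ ∘ₗ b.symm.toLinearMap)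
    have hj : ∀ u, j u = b (j₀ (b.symm u)) := fun u => rfl
    refine (thirdType_inFrame_eq_zero_iff b (A x) j₀ hj₀ j fun u => ?_).2 (h ⟨x, j⟩ fun u => ?_)
    · rw [hj, b.symm_apply_apply]
    · change j (j u) = -u
      rw [hj, hj, b.symm_apply_apply, hj₀, map_neg, b.apply_symm_apply]
  · intro h p hp
    have := hfin p.1
    have hr : Module.finrank ℝ E = Module.finrank ℝ (TangentSpace 𝓘(ℝ, E) p.1) := rfl
    have := hfin p.1
    -- Conversely, every point of `J(M)` is `b j₀ b⁻¹` for some frame `b`.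
    obtain ⟨b, hb⟩ := exists_linearEquiv_comm hr j₀ p.2.toLinearMap hj₀ hp
    exact (thirdType_inFrame_eq_zero_iff b (A p.1) j₀ hj₀ p.2 hb).1 (h p.1 b)

end Frames

end Twistor

end

theorem mainTheorem6 {E : Type*} [NormedAddCommGroup E] [NormedSpace ℝ E] [FiniteDimensional ℝ E]
    {M : Type*} [TopologicalSpace M] [ChartedSpace E M] [IsManifold 𝓘(ℝ, E) ∞ M]
    (cov cov' : CovariantDerivative 𝓘(ℝ, E) E (TangentSpace 𝓘(ℝ, E) : M → Type _))
    (A : ∀ x : M, TangentSpace 𝓘(ℝ, E) x →L[ℝ] TangentSpace 𝓘(ℝ, E) x →L[ℝ]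
      TangentSpace 𝓘(ℝ, E) x)
    (hA : ∀ (Y : ∀ x : M, TangentSpace 𝓘(ℝ, E) x) (x : M),
      MDifferentiableAt 𝓘(ℝ, E) (𝓘(ℝ, E).prod 𝓘(ℝ, E))
        (fun y => (⟨y, Y y⟩ : TangentBundle 𝓘(ℝ, E) M)) x →
      ∀ X : TangentSpace 𝓘(ℝ, E) x, cov' Y x X = cov Y x X + A x X (Y x))
    (j₀ : E →ₗ[ℝ] E) (hj₀ : ∀ u, j₀ (j₀ u) = -u) :
    (∃ k : ℕ, Nonempty (Twistor.IrreducibleDecomposition E k)) ∧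
    ∀ (k : ℕ) (D : Twistor.IrreducibleDecomposition E k),
      Twistor.twistorStructure cov = Twistor.twistorStructure cov' ↔
        ¬ ∃ i : Fin k, Twistor.HasThreeIEigenvalue j₀ (D.summand i).toSubmodule ∧
          ∃ (x : M) (b : E ≃ₗ[ℝ] TangentSpace 𝓘(ℝ, E) x),
            Twistor.irreducibleComponent D i A x b ≠ 0 := by
  refine ⟨Twistor.exists_irreducibleDecomposition E, fun k D => ?_⟩
  rw [Twistor.twistorStructure_eq_iff_inFrame hA j₀ hj₀]
  -- A condition on all frames is already a condition on whole `GL(V)`-orbits, the form in which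
  -- irreducibility can be used.
  have h : (∀ (x : M) (b : E ≃ₗ[ℝ] TangentSpace 𝓘(ℝ, E) x),
      Twistor.thirdType j₀ (Twistor.inFrame b (A x)) = 0) ↔
      ∀ (x : M) (b : E ≃ₗ[ℝ] TangentSpace 𝓘(ℝ, E) x) (g : LinearMap.GeneralLinearGroup ℝ E),
        Twistor.thirdType j₀ (Twistor.tensorRep E g (Twistor.inFrame b (A x))) = 0 := by
    refine ⟨fun h x b g => ?_, fun h x b => ?_⟩
    · rw [Twistor.tensorRep_inFrame]
      exact h x _
    · simpa using h x b 1
  rw [h]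
  simp only [D.forall_thirdType_tensorRep_eq_zero_iff j₀ hj₀]
  constructor
  · rintro h ⟨i, hi, x, b, hne⟩
    exact hne (h x b i hi)
  · intro h x b i hi
    by_contra hne
    exact h ⟨i, hi, x, b, hne⟩
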